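/- Let $\mathcal H$ be a real or complex Hilbert space with an orthonormal basis $\{v_i\}_{i\in\mathbb N}$, and let $\boldsymbol\lambda=\{\lambda_i\}_{i\in\mathbb N}$ and $\{d_i\}_{i\in\mathbb N}$ be two nondecreasing, unbounded sequences of real numbers. Let $E=\operatorname{diag}\boldsymbol\lambda$ be the self-adjoint operator on $\mathcal H$ with domain $$\mathcal D=\Big\{f\in\mathcal H:\ \sum_{i\in\mathbb N}|\lambda_i|^2\,|\langle f,v_i\rangle|^2<\infty\Big\},\qquad Ef=\sum_{i\in\mathbb N}\lambda_i\langle f,v_i\rangle v_i\quad(f\in\mathcal D),$$ so that $Ev_i=\lambda_iv_i$ for all $i$. Suppose that $$\sum_{i=1}^n\lambda_i\le\sum_{i=1}^n d_i\qquad\text{for all }n\in\mathbb N.$$ Then there exists an orthonormal basis $\{e_i\}_{i\in\mathbb N}$ of $\mathcal H$, each of whose elements is a finite linear combination of the vectors $v_j$ (in particular $e_i\in\mathcal D$), such that $\langle Ee_i,e_i\rangle=d_i$ for all $i\in\mathbb N$. -/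

import Mathlib

noncomputable section

namespace SchurHorn

variable {𝕜 : Type*} [RCLike 𝕜] {H : Type*} [NormedAddCommGroup H] [InnerProductSpace 𝕜 H]

theorem memℓp_two_iff (g : ℕ → 𝕜) : Memℓp g 2 ↔ Summable fun i => ‖g i‖ ^ 2 := by
  rw [memℓp_gen_iff (by norm_num)]
  simp

theorem memℓp_mul_iff (lam : ℕ → ℝ) (v : HilbertBasis ℕ 𝕜 H) (f : H) :
    Memℓp (fun i => (lam i : 𝕜) * inner 𝕜 (v i) f) 2 ↔
      Summable fun i => |lam i| ^ 2 * ‖inner 𝕜 (v i) f‖ ^ 2 := by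
  rw [memℓp_two_iff]
  simp only [norm_mul, mul_pow, RCLike.norm_ofReal]

/-- The natural domain `{f : ∑ |λ_i|² |⟨f, v_i⟩|² < ∞}` of `diag λ`. -/
def diagDomain (lam : ℕ → ℝ) (v : HilbertBasis ℕ 𝕜 H) : Submodule 𝕜 H where
  carrier := {f | Summable fun i => |lam i| ^ 2 * ‖inner 𝕜 (v i) f‖ ^ 2}
  zero_mem' := by simp [summable_zero]
  add_mem' := by
    intro f g hf hg
    simp only [Set.mem_ofPred_eq, ← memℓp_mul_iff] at hf hg ⊢
    convert hf.add hg using 1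
    funext i
    simp [inner_add_right, mul_add]
  smul_mem' := by
    intro c f hf
    simp only [Set.mem_ofPred_eq, ← memℓp_mul_iff] at hf ⊢
    convert hf.const_smul c using 1
    funext i
    simp [inner_smul_right]
    ring

/-- The operator `diag λ` relative to the orthonormal basis `v`: on its natural domain, it sends
`f` to the vector with coordinates `λ_i ⟨f, v_i⟩` (the product being linear in `f`), that is, to
`∑ λ_i ⟨f, v_i⟩ v_i`. -/
def diagOp (lam : ℕ → ℝ) (v : HilbertBasis ℕ 𝕜 H) : H →ₗ.[𝕜] H where
  domain := diagDomain lam v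
  toFun :=
    { toFun := fun f => v.repr.symm
        ⟨fun i => (lam i : 𝕜) * inner 𝕜 (v i) (f : H), (memℓp_mul_iff lam v f).2 f.2⟩
      map_add' := by
        intro f g
        rw [← map_add]
        congr 1
        ext i
        exact (congrArg _ (inner_add_right _ _ _)).trans (mul_add _ _ _)
      map_smul' := by
        intro c f
        rw [RingHom.id_apply, ← map_smul]
        congr 1
        ext i
        simp [inner_smul_right]
        ring }

theorem inner_diagOp (lam : ℕ → ℝ) (v : HilbertBasis ℕ 𝕜 H) (f : (diagOp lam v).domain) (i : ℕ) :
    inner 𝕜 (v i) (diagOp lam v f) = (lam i : 𝕜) * inner 𝕜 (v i) (f : H) := by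
  rw [← v.repr_apply_apply]
  change v.repr (v.repr.symm _) i = _
  rw [LinearIsometryEquiv.apply_symm_apply]

theorem basis_mem_domain (lam : ℕ → ℝ) (v : HilbertBasis ℕ 𝕜 H) (i : ℕ) :
    v i ∈ (diagOp lam v).domain := by
  change Summable _
  refine summable_of_ne_finset_zero (s := {i}) fun j hj => ?_
  have hji : j ≠ i := by simpa using hj
  simp [v.orthonormal.2 hji]

/-- `v_i` is an eigenvector of `diag λ` with eigenvalue `λ_i`. -/
theorem diagOp_basis (lam : ℕ → ℝ) (v : HilbertBasis ℕ 𝕜 H) (i : ℕ) :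
    diagOp lam v ⟨v i, basis_mem_domain lam v i⟩ = (lam i : 𝕜) • v i := by
  apply v.repr.injective
  ext j
  rw [v.repr_apply_apply, v.repr_apply_apply, inner_diagOp, inner_smul_right]
  rcases eq_or_ne j i with rfl | h
  · rfl
  · simp [v.orthonormal.2 h]

/-- `diag λ` is densely defined. -/
theorem diagOp_dense (lam : ℕ → ℝ) (v : HilbertBasis ℕ 𝕜 H) :
    Dense ((diagOp lam v).domain : Set H) := by
  have h : Submodule.span 𝕜 (Set.range v) ≤ (diagOp lam v).domain := by
    rw [Submodule.span_le]
    rintro _ ⟨i, rfl⟩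
    exact basis_mem_domain lam v i
  exact (Submodule.dense_iff_topologicalClosure_eq_top.2 v.dense_span).mono h

/-- `diag λ` is self-adjoint. -/
theorem diagOp_isSelfAdjoint [CompleteSpace H] (lam : ℕ → ℝ) (v : HilbertBasis ℕ 𝕜 H) :
    IsSelfAdjoint (diagOp lam v) := by
  have hd := diagOp_dense lam v
  have hf : (diagOp lam v).IsFormalAdjoint (diagOp lam v) := by
    intro x y
    rw [← v.tsum_inner_mul_inner, ← v.tsum_inner_mul_inner]
    refine tsum_congr fun i => ?_
    rw [inner_diagOp, ← inner_conj_symm _ (v i), inner_diagOp, ← inner_conj_symm (x : H) (v i)]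
    simp
    ring
  have hle := hf.le_adjoint hd
  rw [LinearPMap.isSelfAdjoint_def]
  refine (LinearPMap.eq_of_le_of_domain_eq hle (le_antisymm hle.1 fun y hy => ?_)).symm
  change Summable _
  rw [← memℓp_mul_iff]
  convert lp.memℓp (v.repr ((diagOp lam v).adjoint ⟨y, hy⟩)) using 1
  funext i
  have h := (LinearPMap.adjoint_isFormalAdjoint hd) ⟨y, hy⟩ ⟨v i, basis_mem_domain lam v i⟩
  rw [diagOp_basis, inner_smul_right] at h
  rw [v.repr_apply_apply, ← inner_conj_symm (v i) y,
    ← inner_conj_symm (v i) ((diagOp lam v).adjoint _)]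
  refine Eq.trans ?_ (congrArg _ h.symm)
  simp

end SchurHorn

end

/-!
The basis is obtained from `v` by a sequence of finite rotations, each given by Horn's theorem
(`exists_orthogonal_of_majorizedOn`): on finitely many eigenvectors, a diagonal `μ` can be turned
into any diagonal majorizing it. All coefficients are real, so the construction takes place in
`ℕ →₀ ℝ`, with one bilinear form for the inner product and one for the energy, and is carried over
to the Hilbert space at the end.

Cut `ℕ` into consecutive finite blocks. On a block where the sum of `d` differs from that of `lam`,
Horn's theorem can reach `d` on all vectors but one, which is left over with a value below its
target. This deficit is made up with energy from a later block: the left-over vector is rotated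
together with that block, reaches its target, and one vector of the block is left over instead. The
deficit is passed along a chain of blocks towards infinity, and every vector is finished after at
most two rotations.

Passing deficits to infinity endangers completeness of the limit. Let `g` be left over with
deficit `c` below its target `x`. If all values in the next block of its chain exceed `x + c`, then
the unit vector of energy `x` made from `g` and that block has at least half of its mass on `g`
(`half_le_sq_of_gap`), so at most half of `g` goes into the next left-over vector. A vector
orthogonal to all finished ones is then orthogonal to all left-over ones, hence to `v`
(`RotationSchedule.exists_complete`). The gap can be arranged because `lam` is unbounded.

The blocks are chosen from the partial sums `excess` of `d - lam`, which are nonnegative. If the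
excess attains its minimum beyond every index, the blocks end at such minima; then each block has a
surplus of its own, and infinitely many sparse chains are used
(`nonempty_blockPlan_of_attained`). Otherwise, beyond some index the excess has strictly smaller
and smaller records, the blocks end at records, and a single chain carries the whole excess
(`nonempty_blockPlan_of_not_attained`).
-/

/-! ### Horn's theorem for finite matrices -/

/-- The diagonal bilinear form `(x, y) ↦ ∑ w_i x_i y_i` on finitely supported real vectors. -/
noncomputable def diagForm {ι : Type*} (w : ι → ℝ) : (ι →₀ ℝ) →ₗ[ℝ] (ι →₀ ℝ) →ₗ[ℝ] ℝ :=
  Finsupp.linearCombination ℝ fun i => w i • (Finsupp.lapply i : (ι →₀ ℝ) →ₗ[ℝ] ℝ)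

theorem diagForm_apply {ι : Type*} (w : ι → ℝ) (x y : ι →₀ ℝ) :
    diagForm w x y = x.sum fun i a => a * (w i * y i) := by
  simp [diagForm, Finsupp.linearCombination_apply, Finsupp.sum, LinearMap.sum_apply]

theorem diagForm_apply_fintype {ι : Type*} [Fintype ι] (w : ι → ℝ) (x y : ι →₀ ℝ) :
    diagForm w x y = ∑ i, x i * (w i * y i) := by
  rw [diagForm_apply, Finsupp.sum_fintype _ _ (by simp)]

theorem diagForm_single {ι : Type*} [DecidableEq ι] (w : ι → ℝ) (i j : ι) :
    diagForm w (Finsupp.single i 1) (Finsupp.single j 1) = if i = j then w i else 0 := by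
  rw [diagForm_apply, Finsupp.sum_single_index (by simp), Finsupp.single_apply]
  simp [eq_comm]

theorem exists_rotation_coeffs {a b x : ℝ} (ha : a ≤ x) (hb : x < b) :
    ∃ c s : ℝ, c * c + s * s = 1 ∧ c * c * a + s * s * b = x := by
  have hab : 0 < b - a := by linarith
  refine ⟨√((b - x) / (b - a)), √((x - a) / (b - a)), ?_, ?_⟩
  all_goals
    rw [Real.mul_self_sqrt (div_nonneg (by linarith) hab.le),
      Real.mul_self_sqrt (div_nonneg (by linarith) hab.le)]
    field_simp
    ring

/-- Horn's theorem for sorted sequences: vectors `u₀, …, u_{n-1}` orthonormal for `A` and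
orthogonal for `B`, with `B`-values `μ`, can be replaced inside their span by `A`-orthonormal
vectors with `B`-values `t`, provided that `μ` is majorized by `t`. The smallest target `t₀` lies
between two neighbouring values `μ_j` and `μ_{j+1}`; a rotation of `u_j` and `u_{j+1}` splits off a
vector of value `t₀`, and what remains is sorted and majorized again. -/
theorem exists_orthonormal_of_sorted {V : Type*} [AddCommGroup V] [Module ℝ V]
    (A B : V →ₗ[ℝ] V →ₗ[ℝ] ℝ) (n : ℕ) : ∀ (u : ℕ → V) (μ t : ℕ → ℝ)
    (_ : ∀ i < n, ∀ j < n, A (u i) (u j) = if i = j then 1 else 0)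
    (_ : ∀ i < n, ∀ j < n, B (u i) (u j) = if i = j then μ i else 0)
    (_ : ∀ i j, i ≤ j → j < n → μ i ≤ μ j) (_ : ∀ i j, i ≤ j → j < n → t i ≤ t j)
    (_ : ∀ m ≤ n, ∑ i ∈ Finset.range m, μ i ≤ ∑ i ∈ Finset.range m, t i)
    (_ : ∑ i ∈ Finset.range n, μ i = ∑ i ∈ Finset.range n, t i),
    ∃ w : ℕ → V, (∀ i < n, w i ∈ Submodule.span ℝ (u '' Set.Iio n)) ∧
      (∀ i < n, ∀ j < n, A (w i) (w j) = if i = j then 1 else 0) ∧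
      ∀ i < n, B (w i) (w i) = t i := by
  induction n with
  | zero => intro u μ t _ _ _ _ _ _; exact ⟨u, by simp⟩
  | succ n ih =>
    intro u μ t hA hB hμ ht hmaj heq
    by_cases hall : ∀ i < n + 1, μ i ≤ t 0
    · have hle : ∀ i ∈ Finset.range (n + 1), μ i ≤ t i := fun i hi =>
        (hall i (Finset.mem_range.1 hi)).trans (ht 0 i (Nat.zero_le _) (Finset.mem_range.1 hi))
      have h := (Finset.sum_eq_sum_iff_of_le hle).1 heq
      refine ⟨u, fun i hi => Submodule.subset_span ⟨i, hi, rfl⟩, hA, fun i hi => ?_⟩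
      rw [hB i hi i hi, if_pos rfl, h i (Finset.mem_range.2 hi)]
    -- otherwise `j + 1` is the first index with `t 0 < μ (j + 1)`
    · push Not at hall
      classical
      obtain ⟨hk, hkt⟩ := Nat.find_spec hall
      have hmin := fun m (hm : m < Nat.find hall) => Nat.find_min hall hm
      generalize Nat.find hall = k at hk hkt hmin
      have h0 : μ 0 ≤ t 0 := by simpa using hmaj 1 (by omega)
      obtain ⟨j, rfl⟩ : ∃ j, k = j + 1 :=
        Nat.exists_eq_succ_of_ne_zero (by rintro rfl; linarith)
      have hlow : ∀ i ≤ j, μ i ≤ t 0 := by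
        intro i hi
        by_contra! h
        exact hmin i (by omega) ⟨by omega, h⟩
      obtain ⟨c, s, hcs, hct⟩ := exists_rotation_coeffs (hlow j le_rfl) hkt
      -- `g` is split off with value `t 0`, and `f` takes the place of both `u j` and `u (j + 1)`
      set f : V := c • u (j + 1) - s • u j with hf
      set g : V := c • u j + s • u (j + 1) with hg
      set u' : ℕ → V := fun i => if i < j then u i else if i = j then f else u (i + 1) with hu'
      set μ' : ℕ → ℝ := fun i =>
        if i < j then μ i else if i = j then μ j + μ (j + 1) - t 0 else μ (i + 1) with hμ'
      have hj : j < n + 1 := by omega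
      have hj' : j < n := by omega
      have gen : ∀ (Q : V →ₗ[ℝ] V →ₗ[ℝ] ℝ) (q : ℕ → ℝ),
          (∀ i < n + 1, ∀ j < n + 1, Q (u i) (u j) = if i = j then q i else 0) →
          (Q g g = c * c * q j + s * s * q (j + 1)) ∧
          (Q f f = s * s * q j + c * c * q (j + 1)) ∧
          (Q g f = c * s * (q (j + 1) - q j)) ∧ (Q f g = c * s * (q (j + 1) - q j)) ∧
          ∀ i < n + 1, i ≠ j → i ≠ j + 1 →
            Q f (u i) = 0 ∧ Q (u i) f = 0 ∧ Q g (u i) = 0 ∧ Q (u i) g = 0 := by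
        intro Q q hQ
        have e1 := hQ j hj j hj
        have e2 := hQ j hj (j + 1) hk
        have e3 := hQ (j + 1) hk j hj
        have e4 := hQ (j + 1) hk (j + 1) hk
        simp only [if_true, (Nat.succ_ne_self j), (Nat.succ_ne_self j).symm, if_false] at e1 e2 e3 e4
        refine ⟨?_, ?_, ?_, ?_, ?_⟩
        · simp [hg, e1, e2, e3, e4]; ring
        · simp [hf, e1, e2, e3, e4]; ring
        · simp [hf, hg, e1, e2, e3, e4]; ring
        · simp [hf, hg, e1, e2, e3, e4]; ring
        · intro i hi h1 h2
          have e5 := hQ i hi j hj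
          have e6 := hQ i hi (j + 1) hk
          have e7 := hQ j hj i hi
          have e8 := hQ (j + 1) hk i hi
          rw [if_neg h1] at e5
          rw [if_neg h2] at e6
          rw [if_neg h1.symm] at e7
          rw [if_neg h2.symm] at e8
          simp [hf, hg, e5, e6, e7, e8]
      obtain ⟨a1, a2, a3, a4, a5⟩ := gen A (fun _ => 1) hA
      obtain ⟨b1, b2, -, -, b5⟩ := gen B μ hB
      have hff : B f f = μ j + μ (j + 1) - t 0 := by
        rw [b2]; linear_combination -hct + (μ j + μ (j + 1)) * hcs
      have hQ' : ∀ (Q : V →ₗ[ℝ] V →ₗ[ℝ] ℝ) (q q' : ℕ → ℝ),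
          (∀ i < n + 1, ∀ j < n + 1, Q (u i) (u j) = if i = j then q i else 0) →
          (∀ i, i < j → q' i = q i) → q' j = Q f f → (∀ i, j < i → q' i = q (i + 1)) →
          ∀ i < n, ∀ l < n, Q (u' i) (u' l) = if i = l then q' i else 0 := by
        intro Q q q' hQ hq1 hq2 hq3 i hi l hl
        have h5 := (gen Q q hQ).2.2.2.2
        rcases lt_trichotomy i j with h | h | h <;> rcases lt_trichotomy l j with h' | h' | h'
        · simp only [hu', if_pos h, if_pos h', hQ i (by omega) l (by omega), hq1 i h]
        · subst h'
          simp only [hu', if_pos h, lt_irrefl, if_false, if_true, if_neg h.ne]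
          exact (h5 i (by omega) (by omega) (by omega)).2.1
        · simp only [hu', if_pos h, if_neg h'.not_gt, if_neg h'.ne', if_neg (h.trans h').ne]
          rw [hQ i (by omega) (l + 1) (by omega), if_neg (by omega)]
        · rw [h]
          simp only [hu', if_pos h', lt_irrefl, if_false, if_true, if_neg h'.ne']
          exact (h5 l (by omega) (by omega) (by omega)).1
        · rw [h, h']
          simp only [hu', lt_irrefl, if_false, if_true, hq2]
        · rw [h]
          simp only [hu', if_neg h'.not_gt, if_neg h'.ne', if_neg h'.ne, lt_irrefl, if_false,
            if_true]
          exact (h5 (l + 1) (by omega) (by omega) (by omega)).1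
        · simp only [hu', if_pos h', if_neg h.not_gt, if_neg h.ne', if_neg (h'.trans h).ne']
          rw [hQ (i + 1) (by omega) l (by omega), if_neg (by omega)]
        · subst h'
          simp only [hu', if_neg h.not_gt, if_neg h.ne', lt_irrefl, if_false, if_true]
          exact (h5 (i + 1) (by omega) (by omega) (by omega)).2.1
        · simp only [hu', if_neg h.not_gt, if_neg h.ne', if_neg h'.not_gt, if_neg h'.ne', hq3 i h,
            hQ (i + 1) (by omega) (l + 1) (by omega), Nat.succ_inj]
      have hA' := hQ' A (fun _ => 1) (fun _ => 1) hA (fun _ _ => rfl)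
        (by rw [a2]; linarith) (fun _ _ => rfl)
      have hB' := hQ' B μ μ' hB (fun i h => by simp [hμ', h]) (by simp [hμ', hff])
        (fun i h => by simp [hμ', h.not_gt, h.ne'])
      have hμm : ∀ i l, i ≤ l → l < n → μ' i ≤ μ' l := by
        have hjj := hlow j le_rfl
        intro i l hil hl
        simp only [hμ']
        split_ifs
        any_goals omega
        any_goals exact hμ _ _ (by omega) (by omega)
        · have := hμ i j (by omega) (by omega); linarith
        · exact le_rfl
        · have := hμ (j + 1) (l + 1) (by omega) (by omega); linarith
      have hs1 : ∀ m ≤ j, ∑ i ∈ Finset.range m, μ' i = ∑ i ∈ Finset.range m, μ i := by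
        intro m hm
        refine Finset.sum_congr rfl fun i hi => ?_
        have := Finset.mem_range.1 hi
        simp [hμ', show i < j by omega]
      have hs2 : ∀ m, j + 1 ≤ m →
          ∑ i ∈ Finset.range m, μ' i = ∑ i ∈ Finset.range (m + 1), μ i - t 0 := by
        intro m hm
        induction m, hm using Nat.le_induction with
        | base =>
          rw [Finset.sum_range_succ, hs1 j le_rfl, Finset.sum_range_succ _ (j + 1),
            Finset.sum_range_succ _ j]
          simp [hμ']; ring
        | succ m hm ih' =>
          rw [Finset.sum_range_succ, ih', Finset.sum_range_succ _ (m + 1)]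
          simp [hμ', show ¬ m < j by omega, show m ≠ j by omega]; ring
      have hst : ∀ m, ∑ i ∈ Finset.range m, t (i + 1) = ∑ i ∈ Finset.range (m + 1), t i - t 0 := by
        intro m
        rw [Finset.sum_range_succ']; ring
      obtain ⟨w, hw1, hw2, hw3⟩ := ih u' μ' (fun i => t (i + 1)) hA' hB' hμm
        (fun i l h1 h2 => ht _ _ (by omega) (by omega))
        (by
          intro m hm
          rcases le_or_gt m j with h | h
          · rw [hs1 m h]
            refine Finset.sum_le_sum fun i hi => ?_
            have := Finset.mem_range.1 hi
            exact (hlow i (by omega)).trans (ht 0 _ (by omega) (by omega))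
          · rw [hs2 m h, hst]
            linarith [hmaj (m + 1) (by omega)])
        (by rw [hs2 n hj', hst, heq])
      have hu'span : Submodule.span ℝ (u' '' Set.Iio n) ≤
          Submodule.span ℝ (u '' Set.Iio (n + 1)) ⊓ LinearMap.ker (A g) ⊓
            LinearMap.ker (A.flip g) := by
        have hm : ∀ i < n + 1, u i ∈ Submodule.span ℝ (u '' Set.Iio (n + 1)) := fun i hi =>
          Submodule.subset_span ⟨i, hi, rfl⟩
        rw [Submodule.span_le]
        rintro _ ⟨i, hi, rfl⟩
        have hi : i < n := hi
        simp only [hu', SetLike.mem_coe, Submodule.mem_inf, LinearMap.mem_ker,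
          LinearMap.flip_apply]
        split_ifs
        · have := a5 i (by omega) (by omega) (by omega)
          exact ⟨⟨hm _ (by omega), this.2.2.1⟩, this.2.2.2⟩
        · refine ⟨⟨sub_mem (Submodule.smul_mem _ _ (hm _ hk)) (Submodule.smul_mem _ _ (hm _ hj)),
            ?_⟩, ?_⟩
          · rw [a3]; ring
          · rw [a4]; ring
        · have := a5 (i + 1) (by omega) (by omega) (by omega)
          exact ⟨⟨hm _ (by omega), this.2.2.1⟩, this.2.2.2⟩
      have hgspan : g ∈ Submodule.span ℝ (u '' Set.Iio (n + 1)) :=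
        add_mem (Submodule.smul_mem _ _ (Submodule.subset_span ⟨j, hj, rfl⟩))
          (Submodule.smul_mem _ _ (Submodule.subset_span ⟨j + 1, hk, rfl⟩))
      refine ⟨fun i => if i = 0 then g else w (i - 1), ?_, ?_, ?_⟩
      · rintro (_ | i) hi
        · exact hgspan
        · exact (hu'span (hw1 i (by omega))).1.1
      · rintro (_ | i) hi (_ | l) hl
        · simpa [a1] using hcs
        · simpa using (hu'span (hw1 l (by omega))).1.2
        · simpa using (hu'span (hw1 i (by omega))).2
        · simpa using hw2 i (by omega) l (by omega)
      · rintro (_ | i) hi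
        · simpa [b1] using hct
        · simpa using hw3 i (by omega)

/-- Among the sets of a given size, one that takes the smallest values first has the least sum. -/
theorem sum_le_sum_of_card_eq {ι : Type*} [DecidableEq ι] (f : ι → ℝ) {I S : Finset ι}
    (hcard : I.card = S.card) (h : ∀ x ∈ I, ∀ y ∈ S, y ∉ I → f x ≤ f y) :
    ∑ i ∈ I, f i ≤ ∑ i ∈ S, f i := by
  rw [← Finset.sum_sdiff_le_sum_sdiff]
  have hc : (I \ S).card = (S \ I).card := Finset.card_sdiff_comm hcard
  rcases (I \ S).eq_empty_or_nonempty with he | hne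
  · rw [he, Finset.card_empty, eq_comm, Finset.card_eq_zero] at hc
    rw [he, hc]
  · obtain ⟨x, hx, hmax⟩ := Finset.exists_max_image (I \ S) f hne
    have hx' := Finset.mem_sdiff.1 hx
    calc ∑ i ∈ I \ S, f i ≤ (I \ S).card • f x := Finset.sum_le_card_nsmul _ _ _ hmax
      _ = (S \ I).card • f x := by rw [hc]
      _ ≤ ∑ i ∈ S \ I, f i := Finset.card_nsmul_le_sum _ _ _ fun y hy => by
          have hy' := Finset.mem_sdiff.1 hy
          exact h x hx'.1 y hy'.1 hy'.2

/-- `t` majorizes `μ` on `F`: the totals agree, and the sum of `t` over any subset is at least the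
sum of `μ` over some subset of the same size. No ordering of the index set is involved. -/
def MajorizedOn {ι : Type*} (F : Finset ι) (μ t : ι → ℝ) : Prop :=
  (∀ S ⊆ F, ∃ S' ⊆ F, S'.card = S.card ∧ ∑ i ∈ S', μ i ≤ ∑ i ∈ S, t i) ∧
    ∑ i ∈ F, μ i = ∑ i ∈ F, t i

theorem exists_equiv_monotone {ι : Type*} [Fintype ι] (f : ι → ℝ) :
    ∃ e : Fin (Fintype.card ι) ≃ ι, Monotone (f ∘ e) := by
  let e := (Fintype.equivFin ι).symm
  exact ⟨(Tuple.sort (f ∘ e)).trans e, Tuple.monotone_sort (f ∘ e)⟩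

/-- Horn's theorem: a vector `t` majorizing `μ` is the diagonal of an orthogonal conjugate of
`diag μ`. -/
theorem exists_orthogonal_of_majorizedOn {ι : Type*} [Fintype ι] [DecidableEq ι] {μ t : ι → ℝ}
    (h : MajorizedOn Finset.univ μ t) :
    ∃ O : Matrix ι ι ℝ, O * O.transpose = 1 ∧ ∀ i, ∑ j, O i j ^ 2 * μ j = t i := by
  obtain ⟨hle, heq⟩ := h
  obtain ⟨α, hα⟩ := exists_equiv_monotone μ
  obtain ⟨β, hβ⟩ := exists_equiv_monotone t
  generalize Fintype.card ι = n at α β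
  let ext (γ : Fin n ≃ ι) (f : ι → ℝ) (i : ℕ) : ℝ := if hi : i < n then f (γ ⟨i, hi⟩) else 0
  have hext : ∀ (γ : Fin n ≃ ι) (f : ι → ℝ) (i : ℕ) (hi : i < n), ext γ f i = f (γ ⟨i, hi⟩) :=
    fun γ f i hi => dif_pos hi
  let init (γ : Fin n ≃ ι) (m : ℕ) : Finset ι :=
    (Finset.univ.filter fun i : Fin n => (i : ℕ) < m).map γ.toEmbedding
  have hmem : ∀ γ m x, x ∈ init γ m ↔ (γ.symm x : ℕ) < m := by
    intro γ m x
    simp [init]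
  have hsum : ∀ (γ : Fin n ≃ ι) (f : ι → ℝ) (m : ℕ), m ≤ n →
      ∑ i ∈ Finset.range m, ext γ f i = ∑ x ∈ init γ m, f x := by
    intro γ f m hm
    symm
    refine Finset.sum_bij (fun x _ => (γ.symm x : ℕ)) ?_ ?_ ?_ ?_
    · intro x hx; exact Finset.mem_range.2 ((hmem γ m x).1 hx)
    · intro x _ y _ hxy; exact γ.symm.injective (Fin.ext hxy)
    · intro i hi
      have := Finset.mem_range.1 hi
      exact ⟨γ ⟨i, by omega⟩, (hmem _ _ _).2 (by simpa using this), by simp⟩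
    · intro x _
      rw [hext γ f _ (γ.symm x).2]; simp
  have hcard : ∀ (γ : Fin n ≃ ι) (m : ℕ), (init γ m).card =
      (Finset.univ.filter fun i : Fin n => (i : ℕ) < m).card := fun γ m => Finset.card_map _
  have huniv : ∀ γ, init γ n = Finset.univ := by
    intro γ; ext x; simp [hmem]
  let u : ℕ → ι →₀ ℝ := fun i => if hi : i < n then Finsupp.single (α ⟨i, hi⟩) 1 else 0
  have hu : ∀ (q : ι → ℝ), ∀ i < n, ∀ j < n,
      diagForm q (u i) (u j) = if i = j then ext α q i else 0 := by
    intro q i hi j hj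
    simp only [u, dif_pos hi, dif_pos hj, diagForm_single, hext α q i hi, α.injective.eq_iff,
      Fin.mk.injEq]
  obtain ⟨w, -, hw2, hw3⟩ := exists_orthonormal_of_sorted (diagForm fun _ => 1) (diagForm μ) n u
    (ext α μ) (ext β t)
    (by
      intro i hi j hj
      rw [hu _ i hi j hj]; simp only [hext _ _ i hi])
    (hu μ)
    (by
      intro i j hij hj
      rw [hext _ _ i (by omega), hext _ _ j hj]
      exact hα (by simpa using hij))
    (by
      intro i j hij hj
      rw [hext _ _ i (by omega), hext _ _ j hj]
      exact hβ (by simpa using hij))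
    (by
      intro m hm
      rw [hsum _ _ m hm, hsum _ _ m hm]
      obtain ⟨S', -, hc, hS'⟩ := hle (init β m) (Finset.subset_univ _)
      refine le_trans ?_ hS'
      refine sum_le_sum_of_card_eq μ (by rw [hc, hcard, hcard]) fun x hx y _ hy => ?_
      rw [hmem] at hx hy
      have := hα (show α.symm x ≤ α.symm y from Fin.le_def.2 (by omega))
      simpa using this)
    (by rw [hsum _ _ n le_rfl, hsum _ _ n le_rfl, huniv, huniv, heq])
  refine ⟨Matrix.of fun x y => w (β.symm x) y, ?_, ?_⟩
  · ext x y
    have := hw2 _ (β.symm x).2 _ (β.symm y).2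
    rw [diagForm_apply_fintype] at this
    simp only [Fin.val_inj, β.symm.injective.eq_iff, one_mul] at this
    rw [Matrix.mul_apply, Matrix.one_apply, ← this]
    rfl
  · intro x
    have := hw3 _ (β.symm x).2
    rw [diagForm_apply_fintype, hext _ _ _ (β.symm x).2] at this
    simp only [Fin.eta, Equiv.apply_symm_apply] at this
    rw [← this]
    exact Finset.sum_congr rfl fun j _ => by rw [Matrix.of_apply]; ring

/-! ### Changing finitely many vectors of an orthonormal sequence -/

/-- Horn's theorem inside an orthonormal sequence `u`: the vectors with index in `F` are rotated
among themselves so that their `B`-values become `t`, the others stay as they are. The numbers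
`O l j` are the coefficients of the rotation. -/
theorem exists_rotation_of_majorizedOn {V : Type*} [AddCommGroup V] [Module ℝ V]
    (A B : V →ₗ[ℝ] V →ₗ[ℝ] ℝ) (u : ℕ → V) (F : Finset ℕ) (t : ℕ → ℝ)
    (hA : ∀ i j, A (u i) (u j) = if i = j then 1 else 0)
    (hB : ∀ i ∈ F, ∀ j ∈ F, i ≠ j → B (u i) (u j) = 0)
    (hmaj : MajorizedOn F (fun i => B (u i) (u i)) t) :
    ∃ (u' : ℕ → V) (O : ℕ → ℕ → ℝ), (∀ i ∉ F, u' i = u i) ∧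
      (∀ i j, A (u' i) (u' j) = if i = j then 1 else 0) ∧
      (∀ i ∈ F, B (u' i) (u' i) = t i) ∧
      (∀ i, (∀ j ∈ F, B (u i) (u j) = 0 ∧ B (u j) (u i) = 0) →
        ∀ l ∈ F, B (u i) (u' l) = 0 ∧ B (u' l) (u i) = 0) ∧
      (∀ j ∈ F, u j = ∑ l ∈ F, O l j • u' l) ∧
      (∀ l ∈ F, ∑ j ∈ F, O l j ^ 2 = 1) ∧ (∀ j ∈ F, ∑ l ∈ F, O l j ^ 2 = 1) ∧
      ∀ l ∈ F, ∑ j ∈ F, O l j ^ 2 * B (u j) (u j) = t l := by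
  have hmaj' : MajorizedOn (Finset.univ : Finset F) (fun i => B (u i) (u i)) (fun i => t i) := by
    refine ⟨fun S _ => ?_, ?_⟩
    · obtain ⟨S', hS', hc, hle⟩ := hmaj.1 (S.map (Function.Embedding.subtype _))
        (fun x hx => by
          obtain ⟨y, _, rfl⟩ := Finset.mem_map.1 hx
          exact y.2)
      refine ⟨S'.subtype (· ∈ F), Finset.subset_univ _, ?_, ?_⟩
      · rw [Finset.card_subtype, Finset.filter_true_of_mem hS', hc, Finset.card_map]
      · rw [Finset.sum_map] at hle
        refine le_trans (le_of_eq ?_) hle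
        rw [Finset.sum_subtype_eq_sum_filter (f := fun i => B (u i) (u i)),
          Finset.filter_true_of_mem hS']
    · rw [Finset.sum_coe_sort F (fun i => B (u i) (u i)), Finset.sum_coe_sort F t]
      exact hmaj.2
  obtain ⟨M, hM, hMt⟩ := exists_orthogonal_of_majorizedOn hmaj'
  have hM' : M.transpose * M = 1 := mul_eq_one_comm.1 hM
  let O : ℕ → ℕ → ℝ := fun l j => if h : l ∈ F ∧ j ∈ F then M ⟨l, h.1⟩ ⟨j, h.2⟩ else 0
  have hO : ∀ l j : F, O l j = M l j := fun l j => dif_pos ⟨l.2, j.2⟩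
  have hrow : ∀ i ∈ F, ∀ l ∈ F, ∑ j ∈ F, O i j * O l j = if i = l then 1 else 0 := by
    intro i hi l hl
    have := congrFun (congrFun hM ⟨i, hi⟩) ⟨l, hl⟩
    rw [Matrix.mul_apply, Matrix.one_apply] at this
    simp only [Subtype.mk.injEq] at this
    rw [← this, ← Finset.sum_coe_sort]
    exact Finset.sum_congr rfl fun j _ => congrArg₂ _ (hO ⟨i, hi⟩ j) (hO ⟨l, hl⟩ j)
  have hcol : ∀ i ∈ F, ∀ l ∈ F, ∑ j ∈ F, O j i * O j l = if i = l then 1 else 0 := by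
    intro i hi l hl
    have := congrFun (congrFun hM' ⟨i, hi⟩) ⟨l, hl⟩
    rw [Matrix.mul_apply, Matrix.one_apply] at this
    simp only [Subtype.mk.injEq] at this
    rw [← this, ← Finset.sum_coe_sort]
    exact Finset.sum_congr rfl fun j _ => congrArg₂ _ (hO j ⟨i, hi⟩) (hO j ⟨l, hl⟩)
  have hquad : ∀ l ∈ F, ∑ j ∈ F, O l j ^ 2 * B (u j) (u j) = t l := by
    intro l hl
    rw [← hMt ⟨l, hl⟩, ← Finset.sum_coe_sort]
    exact Finset.sum_congr rfl fun j _ => by rw [hO ⟨l, hl⟩ j]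
  let u' : ℕ → V := fun l => if l ∈ F then ∑ j ∈ F, O l j • u j else u l
  have hu' : ∀ l ∈ F, u' l = ∑ j ∈ F, O l j • u j := fun l hl => if_pos hl
  have hu'' : ∀ l ∉ F, u' l = u l := fun l hl => if_neg hl
  have hform : ∀ (Q : V →ₗ[ℝ] V →ₗ[ℝ] ℝ), (∀ i ∈ F, ∀ j ∈ F, i ≠ j → Q (u i) (u j) = 0) →
      ∀ i ∈ F, ∀ l ∈ F, Q (u' i) (u' l) = ∑ j ∈ F, O i j * O l j * Q (u j) (u j) := by
    intro Q hQ i hi l hl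
    rw [hu' i hi, hu' l hl]
    simp only [map_sum, map_smul, LinearMap.sum_apply, LinearMap.smul_apply, smul_eq_mul]
    refine Finset.sum_congr rfl fun j hj => ?_
    rw [Finset.sum_eq_single j]
    · ring
    · intro k hk hkj
      rw [hQ k hk j hj hkj]; ring
    · exact fun h => absurd hj h
  have hzero : ∀ (Q : V →ₗ[ℝ] V →ₗ[ℝ] ℝ) i, (∀ j ∈ F, Q (u i) (u j) = 0 ∧ Q (u j) (u i) = 0) →
      ∀ l ∈ F, Q (u i) (u' l) = 0 ∧ Q (u' l) (u i) = 0 := by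
    intro Q i hi l hl
    rw [hu' l hl]
    simp only [map_sum, map_smul, LinearMap.sum_apply, LinearMap.smul_apply, smul_eq_mul]
    exact ⟨Finset.sum_eq_zero fun j hj => by rw [(hi j hj).1, mul_zero],
      Finset.sum_eq_zero fun j hj => by rw [(hi j hj).2, mul_zero]⟩
  refine ⟨u', O, hu'', ?_, ?_, hzero B, ?_, ?_, ?_, hquad⟩
  · intro i l
    by_cases hi : i ∈ F <;> by_cases hl : l ∈ F
    · rw [hform A (fun i _ j _ hij => by rw [hA, if_neg hij]) i hi l hl, ← hrow i hi l hl]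
      simp [hA]
    · rw [hu'' l hl, if_neg (by rintro rfl; exact hl hi)]
      refine (hzero A l (fun j hj => ?_) i hi).2
      rw [hA, hA, if_neg (by rintro rfl; exact hl hj), if_neg (by rintro rfl; exact hl hj)]
      simp
    · rw [hu'' i hi, if_neg (by rintro rfl; exact hi hl)]
      refine (hzero A i (fun j hj => ?_) l hl).1
      rw [hA, hA, if_neg (by rintro rfl; exact hi hj), if_neg (by rintro rfl; exact hi hj)]
      simp
    · rw [hu'' i hi, hu'' l hl, hA]
  · intro i hi
    rw [hform B hB i hi i hi, ← hquad i hi]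
    exact Finset.sum_congr rfl fun j _ => by ring
  · intro j hj
    calc u j = ∑ k ∈ F, (∑ l ∈ F, O l j * O l k) • u k := by
          rw [Finset.sum_eq_single j]
          · rw [hcol j hj j hj, if_pos rfl, one_smul]
          · intro k hk hkj
            rw [hcol j hj k hk, if_neg hkj.symm, zero_smul]
          · exact fun h => absurd hj h
      _ = ∑ l ∈ F, O l j • u' l := by
          simp only [Finset.sum_smul]
          rw [Finset.sum_comm]
          refine Finset.sum_congr rfl fun l hl => ?_
          rw [hu' l hl, Finset.smul_sum]
          exact Finset.sum_congr rfl fun k _ => mul_smul _ _ _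
  · intro l hl
    simpa [sq] using hrow l hl l hl
  · intro l hl
    simpa [sq] using hcol l hl l hl

/-- If a unit vector has energy `x`, and all levels but the `i`-th, which is `x - c`, exceed
`x + c`, then at least half of its mass is at level `i`. -/
theorem half_le_sq_of_gap {F : Finset ℕ} {a μ : ℕ → ℝ} {i : ℕ} {x c : ℝ} (hi : i ∈ F)
    (hsum : ∑ j ∈ F, a j ^ 2 = 1) (hx : ∑ j ∈ F, a j ^ 2 * μ j = x) (hc : 0 ≤ c)
    (hμi : μ i = x - c) (hμ : ∀ j ∈ F, j ≠ i → x + c < μ j) : 1 / 2 ≤ a i ^ 2 := by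
  by_contra! hlt
  rw [← Finset.add_sum_erase F _ hi] at hsum hx
  have hex : ∃ j ∈ F.erase i, a j ≠ 0 := by
    by_contra! h
    rw [Finset.sum_eq_zero (fun j hj => by rw [h j hj]; ring)] at hsum
    linarith
  have hpos : 0 < ∑ j ∈ F.erase i, a j ^ 2 * (μ j - (x + c)) := by
    refine Finset.sum_pos' (fun j hj => ?_) ?_
    · have := hμ j (Finset.mem_of_mem_erase hj) (Finset.ne_of_mem_erase hj)
      exact mul_nonneg (sq_nonneg _) (by linarith)
    · obtain ⟨j, hj, ha⟩ := hex
      have := hμ j (Finset.mem_of_mem_erase hj) (Finset.ne_of_mem_erase hj)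
      exact ⟨j, hj, mul_pos (by positivity) (by linarith)⟩
  simp only [mul_sub, Finset.sum_sub_distrib, ← Finset.sum_mul] at hpos
  rw [eq_sub_of_add_eq' hsum, eq_sub_of_add_eq' hx, hμi] at hpos
  nlinarith

/-! ### Schedules of rotations -/

/-- The values during a schedule of rotations, just before stage `k`: the vector with index `i` has
value `lam i` until it is first rotated at stage `first i`, then it carries the deficit `c i`, and
after its last rotation, at stage `last i`, it has reached the value `d i`. -/
noncomputable def stageValue (lam d c : ℕ → ℝ) (first last : ℕ → ℕ) (k i : ℕ) : ℝ :=
  if k ≤ first i then lam i else if k ≤ last i then d i - c i else d i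

/-- The numerical data of a sequence of finite rotations that turns the diagonal `lam` into the
diagonal `d`. At stage `k` the vectors with index in `F k` are rotated, each index being involved
once, at stage `first i`, or twice, at stages `first i < last i`. Every stage leaves at most one of
its vectors unfinished; the vector with index `i`, left unfinished with value `d i - c i`, is
rotated again together with fresh vectors of value larger than `d i + c i` only. -/
structure RotationSchedule (lam d : ℕ → ℝ) where
  first : ℕ → ℕ
  last : ℕ → ℕ
  c : ℕ → ℝ
  F : ℕ → Finset ℕ
  first_le_last : ∀ i, first i ≤ last i
  mem_F : ∀ k i, i ∈ F k ↔ first i = k ∨ last i = k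
  unique : ∀ k, ∀ i ∈ F k, ∀ j ∈ F k, k < last i → k < last j → i = j
  majorized : ∀ k, MajorizedOn (F k) (stageValue lam d c first last k)
    (stageValue lam d c first last (k + 1))
  c_nonneg : ∀ i, 0 ≤ c i
  gap : ∀ i, first i < last i → ∀ j ∈ F (last i), j ≠ i → first j = last i ∧ d i + c i < lam j

namespace RotationSchedule

variable {lam d : ℕ → ℝ}

/-- The values `stageValue` of a schedule. -/
noncomputable def value (R : RotationSchedule lam d) (k i : ℕ) : ℝ := stageValue lam d R.c R.first R.last k i

variable {V : Type*} [AddCommGroup V] [Module ℝ V] (A B : V →ₗ[ℝ] V →ₗ[ℝ] ℝ)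

/-- The state of the vectors before stage `k`: they are `A`-orthonormal, have the scheduled
`B`-values, and those that are still to be rotated are `B`-orthogonal. -/
def Invariant (R : RotationSchedule lam d) (k : ℕ) (u : ℕ → V) : Prop :=
  (∀ i j, A (u i) (u j) = if i = j then 1 else 0) ∧
    (∀ i j, k ≤ R.last i → k ≤ R.last j → i ≠ j → B (u i) (u j) = 0) ∧
    ∀ i, B (u i) (u i) = R.value k i

/-- The effect of stage `k`, with the coefficients `O` of the rotation. -/
def Step (R : RotationSchedule lam d) (k : ℕ) (u u' : ℕ → V) (O : ℕ → ℕ → ℝ) : Prop :=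
  (∀ i ∉ R.F k, u' i = u i) ∧
    (∀ j ∈ R.F k, u j = ∑ l ∈ R.F k, O l j • u' l) ∧
    (∀ l ∈ R.F k, ∑ j ∈ R.F k, O l j ^ 2 = 1) ∧
    (∀ j ∈ R.F k, ∑ l ∈ R.F k, O l j ^ 2 = 1) ∧
    ∀ l ∈ R.F k, ∑ j ∈ R.F k, O l j ^ 2 * R.value k j = R.value (k + 1) l

theorem le_last_of_mem (R : RotationSchedule lam d) {k i : ℕ} (h : i ∈ R.F k) : k ≤ R.last i := by
  have := R.first_le_last i
  rcases (R.mem_F k i).1 h with h | h <;> omega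

theorem exists_step (R : RotationSchedule lam d) (k : ℕ) (u : ℕ → V) (hu : R.Invariant A B k u) :
    ∃ u', R.Invariant A B (k + 1) u' ∧ ∃ O, R.Step k u u' O := by
  obtain ⟨hA, hB, hval⟩ := hu
  have hmaj := R.majorized k
  obtain ⟨u', O, h1, h2, h3, h4, h5, h6, h7, h8⟩ :=
    exists_rotation_of_majorizedOn A B u (R.F k) (R.value (k + 1)) hA
      (fun i hi j hj => hB i j (R.le_last_of_mem hi) (R.le_last_of_mem hj))
      (by simp only [hval]; exact hmaj)
  have hout : ∀ i, k + 1 ≤ R.last i → i ∉ R.F k → ∀ l ∈ R.F k,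
      B (u i) (u' l) = 0 ∧ B (u' l) (u i) = 0 := by
    intro i hik hi
    refine h4 i fun j hj => ?_
    have hij : i ≠ j := by rintro rfl; exact hi hj
    exact ⟨hB i j (by omega) (R.le_last_of_mem hj) hij,
      hB j i (R.le_last_of_mem hj) (by omega) hij.symm⟩
  refine ⟨u', ⟨h2, ?_, ?_⟩, O, h1, h5, h6, h7, by simpa only [hval] using h8⟩
  · intro i j hi hj hij
    by_cases hiF : i ∈ R.F k <;> by_cases hjF : j ∈ R.F k
    · exact absurd (R.unique k i hiF j hjF hi hj) hij
    · rw [h1 j hjF]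
      exact (hout j hj hjF i hiF).2
    · rw [h1 i hiF]
      exact (hout i hi hiF j hjF).1
    · rw [h1 i hiF, h1 j hjF]
      exact hB i j (by omega) (by omega) hij
  · intro i
    by_cases hiF : i ∈ R.F k
    · exact h3 i hiF
    · rw [h1 i hiF, hval]
      rw [R.mem_F] at hiF
      push Not at hiF
      have e1 : k ≤ R.first i ↔ k + 1 ≤ R.first i := by omega
      have e2 : k ≤ R.last i ↔ k + 1 ≤ R.last i := by omega
      simp only [value, stageValue, e1, e2]

theorem exists_stages (R : RotationSchedule lam d) (v : ℕ → V) (hv : R.Invariant A B 0 v) :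
    ∃ U : ℕ → ℕ → V, U 0 = v ∧ (∀ k, R.Invariant A B k (U k)) ∧
      ∀ k, ∃ O, R.Step k (U k) (U (k + 1)) O := by
  choose f hf using fun (k : ℕ) (u : {u : ℕ → V // R.Invariant A B k u}) =>
    R.exists_step A B k u.1 u.2
  let U : (k : ℕ) → {u : ℕ → V // R.Invariant A B k u} := fun k =>
    Nat.rec (motive := fun k => {u : ℕ → V // R.Invariant A B k u}) ⟨v, hv⟩
      (fun k u => ⟨f k u, (hf k u).1⟩) k
  exact ⟨fun k => (U k).1, rfl, fun k => (U k).2, fun k => (hf k (U k)).2⟩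

/-- Carrying out a schedule yields an orthonormal sequence `e` with the prescribed values. It is
complete: a bounded functional `φ` that vanishes on `e` takes on each unfinished vector `g` a
multiple, by a coefficient of square at most `1 / 2`, of its value on the unfinished vector left by
the stage that finishes `g`. By iteration `φ` vanishes on all unfinished vectors, hence on `v`. -/
theorem exists_complete (R : RotationSchedule lam d) {W : Type*} [NormedAddCommGroup W]
    [NormedSpace ℝ W] (v : ℕ → V)
    (hvA : ∀ i j, A (v i) (v j) = if i = j then 1 else 0)
    (hvB : ∀ i j, B (v i) (v j) = if i = j then lam i else 0) :
    ∃ e : ℕ → V, (∀ i j, A (e i) (e j) = if i = j then 1 else 0) ∧ (∀ i, B (e i) (e i) = d i) ∧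
      ∀ (φ : V →ₗ[ℝ] W) (C : ℝ), (∀ x, A x x = 1 → ‖φ x‖ ≤ C) → (∀ i, φ (e i) = 0) →
        ∀ i, φ (v i) = 0 := by
  have hinv : R.Invariant A B 0 v := by
    refine ⟨hvA, fun i j _ _ hij => by rw [hvB, if_neg hij], fun i => ?_⟩
    simp [hvB, value, stageValue]
  obtain ⟨U, hU0, hInv, hStep⟩ := R.exists_stages A B v hinv
  have hconst : ∀ i a b, a ≤ b → (∀ k, a ≤ k → k < b → R.first i ≠ k ∧ R.last i ≠ k) →
      U b i = U a i := by
    intro i a b hab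
    induction b, hab using Nat.le_induction with
    | base => intro _; rfl
    | succ b hab ih =>
      intro h
      obtain ⟨O, hO⟩ := hStep b
      have hb := h b hab (Nat.lt_succ_self b)
      rw [hO.1 i (by rw [R.mem_F]; tauto)]
      exact ih fun k h1 h2 => h k h1 (by omega)
  have hlast : ∀ i k, R.last i < k → U k i = U (R.last i + 1) i := by
    intro i k hk
    have := R.first_le_last i
    exact hconst i _ _ hk fun m h1 h2 => by omega
  have hfirst : ∀ i, U (R.first i) i = v i := by
    intro i
    have := R.first_le_last i
    rw [← hU0]
    exact hconst i _ _ (Nat.zero_le _) fun m h1 h2 => by omega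
  have hmid : ∀ i k, R.first i < k → k ≤ R.last i → U (R.last i) i = U k i := by
    intro i k h h'
    exact hconst i _ _ h' fun m h1 h2 => by omega
  refine ⟨fun i => U (R.last i + 1) i, ?_, ?_, ?_⟩
  · intro i j
    have hi := hlast i (max (R.last i) (R.last j) + 1) (by omega)
    have hj := hlast j (max (R.last i) (R.last j) + 1) (by omega)
    beta_reduce
    rw [← hi, ← hj]
    exact (hInv _).1 i j
  · intro i
    have := R.first_le_last i
    rw [(hInv _).2.2 i, value, stageValue, if_neg (by omega), if_neg (by omega)]
  · intro φ C hφ he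
    beta_reduce at he
    have hC : 0 ≤ C := (norm_nonneg _).trans (hφ (v 0) (by simp [hvA]))
    -- only the unfinished vector of a stage contributes to the values of `φ` before that stage
    have key : ∀ k O, R.Step k (U k) (U (k + 1)) O → ∀ j ∈ R.F k, φ (U k j) = 0 ∨
        ∃ p ∈ R.F k, R.first p = k ∧ k < R.last p ∧
          φ (U k j) = O p j • φ (U (R.last p) p) := by
      intro k O hO j hj
      have hfin : ∀ l ∈ R.F k, ¬ k < R.last l → φ (U (k + 1) l) = 0 := by
        intro l hl hkl
        have := R.le_last_of_mem hl
        have hk : R.last l = k := by omega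
        rw [← hk]
        exact he l
      rw [hO.2.1 j hj, map_sum]
      simp only [map_smul]
      by_cases hp : ∃ p ∈ R.F k, k < R.last p
      · obtain ⟨p, hpF, hp⟩ := hp
        have hpk : R.first p = k := by
          rcases (R.mem_F k p).1 hpF with h | h <;> omega
        refine Or.inr ⟨p, hpF, hpk, hp, ?_⟩
        rw [hmid p (k + 1) (by omega) hp]
        refine Finset.sum_eq_single_of_mem p hpF fun l hl hlp => ?_
        rw [hfin l hl fun h => hlp (R.unique k l hl p hpF h hp), smul_zero]
      · push Not at hp
        exact Or.inl <| Finset.sum_eq_zero fun l hl => by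
          rw [hfin l hl (hp l hl).not_gt, smul_zero]
    have hhalf : ∀ s : ℕ, ∀ i, R.first i < R.last i →
        ‖φ (U (R.last i) i)‖ ^ 2 ≤ (1 / 2) ^ s * C ^ 2 := by
      intro s
      induction s with
      | zero =>
        intro i _
        rw [pow_zero, one_mul]
        exact pow_le_pow_left₀ (norm_nonneg _) (hφ _ (by rw [(hInv _).1, if_pos rfl])) 2
      | succ s ih =>
        intro i hi
        have hiF : i ∈ R.F (R.last i) := (R.mem_F _ _).2 (Or.inr rfl)
        obtain ⟨O, hO⟩ := hStep (R.last i)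
        rcases key _ O hO i hiF with h | ⟨p, hpF, hp1, hp2, h⟩
        · rw [h, norm_zero, zero_pow two_ne_zero]; positivity
        · have hip : p ≠ i := by rintro rfl; omega
          have hval1 : R.value (R.last i + 1) i = d i := by
            rw [value, stageValue, if_neg (by omega), if_neg (by omega)]
          have hO1 : 1 / 2 ≤ O i i ^ 2 := by
            refine half_le_sq_of_gap (x := d i) (c := R.c i) hiF (hO.2.2.1 i hiF)
              ((hO.2.2.2.2 i hiF).trans hval1) (R.c_nonneg i) ?_ ?_
            · rw [value, stageValue, if_neg (by omega), if_pos le_rfl]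
            · intro j hj hji
              obtain ⟨hj1, hj2⟩ := R.gap i hi j hj hji
              rwa [value, stageValue, if_pos hj1.ge]
          have hO2 : O p i ^ 2 ≤ 1 / 2 := by
            have hcol := hO.2.2.2.1 i hiF
            rw [← Finset.add_sum_erase _ _ hiF] at hcol
            have := Finset.single_le_sum (f := fun l => O l i ^ 2) (fun l _ => sq_nonneg _)
              (Finset.mem_erase.2 ⟨hip, hpF⟩)
            linarith
          rw [h, norm_smul, mul_pow, Real.norm_eq_abs, sq_abs, pow_succ' (1 / 2 : ℝ) s, mul_assoc]
          exact mul_le_mul hO2 (ih p (by omega)) (by positivity) (by norm_num)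
    have hzero : ∀ i, R.first i < R.last i → φ (U (R.last i) i) = 0 := by
      intro i hi
      have hlim : Filter.Tendsto (fun s : ℕ => ((1 : ℝ) / 2) ^ s * C ^ 2) Filter.atTop (nhds 0) := by
        simpa using (tendsto_pow_atTop_nhds_zero_of_lt_one (r := (1 : ℝ) / 2) (by norm_num)
          (by norm_num)).mul_const (C ^ 2)
      have := ge_of_tendsto' hlim fun s => hhalf s i hi
      simpa using le_antisymm this (by positivity)
    intro i
    obtain ⟨O, hO⟩ := hStep (R.first i)
    rw [← hfirst i]
    rcases key _ O hO i ((R.mem_F _ _).2 (Or.inl rfl)) with h | ⟨p, hpF, hp1, hp2, h⟩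
    · exact h
    · rw [h, hzero p (by omega), smul_zero]

end RotationSchedule

/-! ### Schedules from a partition into consecutive blocks -/

theorem MajorizedOn.congr {ι : Type*} {F : Finset ι} {μ t μ' t' : ι → ℝ} (h : MajorizedOn F μ t)
    (hμ : ∀ i ∈ F, μ' i = μ i) (ht : ∀ i ∈ F, t' i = t i) : MajorizedOn F μ' t' := by
  refine ⟨fun S hS => ?_, ?_⟩
  · obtain ⟨S', hS', hc, hle⟩ := h.1 S hS
    refine ⟨S', hS', hc, ?_⟩
    rwa [Finset.sum_congr rfl fun i hi => hμ i (hS' hi),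
      Finset.sum_congr rfl fun i hi => ht i (hS hi)]
  · rw [Finset.sum_congr rfl hμ, Finset.sum_congr rfl ht, h.2]

/-- `∑_{i < n} (d i - lam i)`, which is nonnegative for all `n` when `d` majorizes `lam`. -/
noncomputable def excess (lam d : ℕ → ℝ) (n : ℕ) : ℝ := ∑ i ∈ Finset.range n, (d i - lam i)

theorem excess_zero (lam d : ℕ → ℝ) : excess lam d 0 = 0 := by simp [excess]

theorem excess_succ (lam d : ℕ → ℝ) (n : ℕ) :
    excess lam d (n + 1) = excess lam d n + (d n - lam n) := by
  rw [excess, Finset.sum_range_succ, ← excess]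

theorem sum_Ico_eq_add_excess (lam d : ℕ → ℝ) {a b : ℕ} (h : a ≤ b) :
    ∑ i ∈ Finset.Ico a b, d i =
      ∑ i ∈ Finset.Ico a b, lam i + (excess lam d b - excess lam d a) := by
  rw [excess, excess, ← Finset.sum_Ico_eq_sub _ h, Finset.sum_sub_distrib]
  ring

/-- `d` with its `q`-th entry lowered by `c`. -/
noncomputable def lowered (d : ℕ → ℝ) (q : ℕ) (c : ℝ) (i : ℕ) : ℝ := if i = q then d i - c else d i

theorem sum_lowered (d : ℕ → ℝ) {q : ℕ} (c : ℝ) {S : Finset ℕ} (h : q ∈ S) :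
    ∑ i ∈ S, lowered d q c i = ∑ i ∈ S, d i - c := by
  rw [← Finset.add_sum_erase S _ h, ← Finset.add_sum_erase S d h]
  rw [Finset.sum_congr rfl fun i hi => by
    rw [lowered, if_neg (Finset.ne_of_mem_erase hi)]]
  simp [lowered]
  ring

theorem sum_lowered_of_notMem (d : ℕ → ℝ) {q : ℕ} (c : ℝ) {S : Finset ℕ} (h : q ∉ S) :
    ∑ i ∈ S, lowered d q c i = ∑ i ∈ S, d i :=
  Finset.sum_congr rfl fun i hi => if_neg (by rintro rfl; exact h hi)

/-- A partition of `ℕ` into the blocks `[n k, n (k + 1))`, organized into chains by a successor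
function `σ`. The rotation of block `k` reaches the targets `d` on it, except that the vector with
index `q k` is left with a deficit `C k`; this vector is finished together with block `σ k`, whose
values are large compared to its own. -/
structure BlockPlan (lam d : ℕ → ℝ) where
  n : ℕ → ℕ
  q : ℕ → ℕ
  σ : ℕ → ℕ
  C : ℕ → ℝ
  n_zero : n 0 = 0
  n_strictMono : StrictMono n
  le_q : ∀ k, n k ≤ q k
  q_lt : ∀ k, q k < n (k + 1)
  σ_injective : Function.Injective σ
  lt_σ : ∀ k, k < σ k
  C_nonneg : ∀ k, 0 ≤ C k
  chain : ∀ j, MajorizedOn (insert (q j) (Finset.Ico (n (σ j)) (n (σ j + 1))))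
    (fun i => if i = q j then d i - C j else lam i) (lowered d (q (σ j)) (C (σ j)))
  root : ∀ k, (∀ j, σ j ≠ k) →
    MajorizedOn (Finset.Ico (n k) (n (k + 1))) lam (lowered d (q k) (C k))
  gap : ∀ j, ∀ i ∈ Finset.Ico (n (σ j)) (n (σ j + 1)), d (q j) + C j < lam i

theorem BlockPlan.nonempty_schedule {lam d : ℕ → ℝ} (P : BlockPlan lam d) :
    Nonempty (RotationSchedule lam d) := by
  have hex : ∀ i, ∃ k, P.n k ≤ i ∧ i < P.n (k + 1) := by
    intro i
    have h0 : ∃ k, i < P.n (k + 1) := ⟨i, P.n_strictMono.le_apply⟩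
    classical
    refine ⟨Nat.find h0, ?_, Nat.find_spec h0⟩
    rcases hk : Nat.find h0 with _ | k
    · rw [P.n_zero]; exact Nat.zero_le _
    · exact not_lt.1 (Nat.find_min h0 (m := k) (by omega))
  choose blk hblk1 hblk2 using hex
  have huniq : ∀ i k, P.n k ≤ i → i < P.n (k + 1) → blk i = k := by
    intro i k h1 h2
    have a1 := P.n_strictMono.lt_iff_lt.1 ((hblk1 i).trans_lt h2)
    have a2 := P.n_strictMono.lt_iff_lt.1 (h1.trans_lt (hblk2 i))
    omega
  have hblk : ∀ i k, blk i = k ↔ i ∈ Finset.Ico (P.n k) (P.n (k + 1)) := by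
    intro i k
    rw [Finset.mem_Ico]
    exact ⟨by rintro rfl; exact ⟨hblk1 i, hblk2 i⟩, fun h => huniq i k h.1 h.2⟩
  have hq : ∀ k, blk (P.q k) = k := fun k => huniq _ _ (P.le_q k) (P.q_lt k)
  let last : ℕ → ℕ := fun i => if i = P.q (blk i) then P.σ (blk i) else blk i
  have hlast1 : ∀ k, last (P.q k) = P.σ k := fun k => by simp [last, hq]
  have hlast2 : ∀ i, i ≠ P.q (blk i) → last i = blk i := fun i h => if_neg h
  have hle : ∀ i, blk i ≤ last i := by
    intro i
    by_cases h : i = P.q (blk i)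
    · have := hlast1 (blk i)
      rw [← h] at this
      rw [this]
      exact (P.lt_σ _).le
    · rw [hlast2 i h]
  have hlt : ∀ i, blk i < last i → i = P.q (blk i) := by
    intro i h
    by_contra h'
    rw [hlast2 i h'] at h
    omega
  let F : ℕ → Finset ℕ := fun k =>
    (Finset.range (P.n (k + 1))).filter fun i => blk i = k ∨ last i = k
  have hF : ∀ k i, i ∈ F k ↔ blk i = k ∨ last i = k := by
    intro k i
    simp only [F, Finset.mem_filter, Finset.mem_range, and_iff_right_iff_imp]
    intro h
    have hk : blk i ≤ k := by
      have := hle i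
      omega
    exact (hblk2 i).trans_le (P.n_strictMono.monotone (by omega))
  have hF' : ∀ k i, i ∈ F k → blk i = k ∨ ∃ j, P.σ j = k ∧ i = P.q j := by
    intro k i hi
    by_cases h : blk i = k
    · exact Or.inl h
    · have h' := ((hF k i).1 hi).resolve_left h
      have hiq := hlt i (lt_of_le_of_ne (hle i) (by rwa [h']))
      refine Or.inr ⟨blk i, ?_, hiq⟩
      rw [← h', ← hlast1, ← hiq]
  let c : ℕ → ℝ := fun i => P.C (blk i)
  have hin : ∀ k i, blk i = k → stageValue lam d c blk last k i = lam i := by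
    rintro k i rfl
    rw [stageValue, if_pos le_rfl]
  have hout : ∀ k i, blk i = k →
      stageValue lam d c blk last (k + 1) i = lowered d (P.q k) (P.C k) i := by
    rintro k i rfl
    rw [stageValue, if_neg (by omega), lowered]
    by_cases h : i = P.q (blk i)
    · have h1 := hlast1 (blk i)
      rw [← h] at h1
      rw [if_pos h, if_pos (by rw [h1]; exact P.lt_σ _)]
    · rw [if_neg h, hlast2 i h, if_neg (by omega)]
  refine ⟨⟨blk, last, c, F, hle, hF, ?_, ?_, fun i => P.C_nonneg _, ?_⟩⟩
  · have aux : ∀ k, ∀ i ∈ F k, k < last i → i = P.q k := by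
      intro k i hi hk
      have h := ((hF k i).1 hi).resolve_right hk.ne'
      subst h
      exact hlt i hk
    intro k i hi j hj h1 h2
    rw [aux k i hi h1, aux k j hj h2]
  · intro k
    by_cases hk : ∃ j, P.σ j = k
    · obtain ⟨j, rfl⟩ := hk
      have hj := P.lt_σ j
      have hFeq : F (P.σ j) = insert (P.q j) (Finset.Ico (P.n (P.σ j)) (P.n (P.σ j + 1))) := by
        ext i
        rw [Finset.mem_insert, ← hblk]
        constructor
        · intro hi
          rcases hF' _ i hi with h | ⟨j', h, rfl⟩
          · exact Or.inr h
          · exact Or.inl (by rw [P.σ_injective h])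
        · rintro (rfl | h)
          · exact (hF _ _).2 (Or.inr (hlast1 j))
          · exact (hF _ _).2 (Or.inl h)
      have hne : ∀ i, blk i = P.σ j → i ≠ P.q j := by
        rintro i h rfl
        rw [hq] at h
        omega
      rw [hFeq]
      refine (P.chain j).congr ?_ ?_
      · intro i hi
        rw [Finset.mem_insert, ← hblk] at hi
        rcases hi with rfl | hi
        · rw [if_pos rfl, stageValue, hq, hlast1, if_neg (by omega), if_pos le_rfl]
          simp only [c, hq]
        · rw [if_neg (hne i hi), hin _ _ hi]
      · intro i hi
        rw [Finset.mem_insert, ← hblk] at hi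
        rcases hi with rfl | hi
        · have hne' : P.q j ≠ P.q (P.σ j) := fun h => hne _ (hq (P.σ j)) h.symm
          rw [stageValue, hq, hlast1, if_neg (by omega), if_neg (by omega), lowered, if_neg hne']
        · exact hout _ _ hi
    · push Not at hk
      have hFeq : F k = Finset.Ico (P.n k) (P.n (k + 1)) := by
        ext i
        rw [← hblk]
        refine ⟨fun hi => ?_, fun hi => (hF _ _).2 (Or.inl hi)⟩
        rcases hF' _ i hi with h | ⟨j, h, -⟩
        · exact h
        · exact absurd h (hk j)
      rw [hFeq]
      exact (P.root k hk).congr (fun i hi => hin _ _ ((hblk _ _).2 hi))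
        (fun i hi => hout _ _ ((hblk _ _).2 hi))
  · intro i hi j hj hji
    have hiq := hlt i hi
    have hlasti : last i = P.σ (blk i) := by
      have := hlast1 (blk i)
      rwa [← hiq] at this
    rw [hlasti] at hj ⊢
    rcases hF' _ j hj with h | ⟨j', h, hj'⟩
    · refine ⟨h, ?_⟩
      have := P.gap (blk i) j ((hblk _ _).1 h)
      rwa [← hiq] at this
    · refine absurd ?_ hji
      rw [hj', P.σ_injective h, ← hiq]

/-! ### Majorization on blocks -/

/-- A block at whose right end the excess is minimal: the surplus of `d` over `lam` on the block is
taken off the smallest target. -/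
theorem majorizedOn_Ico {lam d : ℕ → ℝ} (hd : Monotone d) {a b : ℕ} (hab : a < b)
    (hmin : ∀ m, a < m → m ≤ b → excess lam d b ≤ excess lam d m)
    (hnonneg : excess lam d a ≤ excess lam d b) :
    MajorizedOn (Finset.Ico a b) lam (lowered d a (excess lam d b - excess lam d a)) := by
  refine ⟨fun S hS => ?_, ?_⟩
  · rcases S.eq_empty_or_nonempty with rfl | hne
    · exact ⟨∅, by simp⟩
    have hcard := Finset.card_le_card hS
    rw [Nat.card_Ico] at hcard
    have hpos := hne.card_pos
    refine ⟨Finset.Ico a (a + S.card), Finset.Ico_subset_Ico le_rfl (by omega), by simp, ?_⟩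
    refine le_trans ?_ (sum_le_sum_of_card_eq _ (I := Finset.Ico a (a + S.card)) (by simp) ?_)
    · rw [sum_lowered d _ (Finset.mem_Ico.2 ⟨le_rfl, by omega⟩),
        sum_Ico_eq_add_excess lam d (by omega)]
      have := hmin (a + S.card) (by omega) (by omega)
      linarith
    · intro x hx y hy hyI
      rw [Finset.mem_Ico] at hx hyI
      have hya := Finset.mem_Ico.1 (hS hy)
      have hxy := hd (show x ≤ y by omega)
      rw [lowered, lowered, if_neg (show y ≠ a by omega)]
      split_ifs <;> linarith
  · rw [sum_lowered d _ (Finset.mem_Ico.2 ⟨le_rfl, hab⟩), sum_Ico_eq_add_excess lam d hab.le]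
    ring

/-- The same together with a vector `q` left over with deficit `c` from an earlier block. -/
theorem majorizedOn_insert_Ico {lam d : ℕ → ℝ} (hd : Monotone d) {q a b : ℕ} {c c' : ℝ}
    (hqa : q < a) (hab : a < b) (hc : 0 ≤ c)
    (hmin : ∀ m, a < m → m ≤ b → excess lam d b ≤ excess lam d m)
    (hc' : c' = c + (excess lam d b - excess lam d a)) (hc'0 : 0 ≤ c') (hgap : d q + c < lam a) :
    MajorizedOn (insert q (Finset.Ico a b)) (fun i => if i = q then d i - c else lam i)
      (lowered d a c') := by
  have hq : ∀ m, q ∉ Finset.Ico a m := fun m h => by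
    have := Finset.mem_Ico.1 h
    omega
  have hμ : ∀ m, ∑ i ∈ insert q (Finset.Ico a m), (if i = q then d i - c else lam i) =
      d q - c + ∑ i ∈ Finset.Ico a m, lam i := by
    intro m
    rw [Finset.sum_insert (hq m), if_pos rfl]
    congr 1
    exact Finset.sum_congr rfl fun i hi => if_neg (by rintro rfl; exact hq m hi)
  -- the lowered target at `a` is at least `lam a - c`, so `q` remains the smallest target
  have hlow : d q ≤ d a - c' := by
    have := hmin (a + 1) (by omega) (by omega)
    rw [excess_succ lam d a] at this
    linarith
  have hqlow : lowered d a c' q = d q := if_neg (by omega)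
  refine ⟨fun S hS => ?_, ?_⟩
  · rcases S.eq_empty_or_nonempty with rfl | hne
    · exact ⟨∅, by simp⟩
    have hcard := Finset.card_le_card hS
    rw [Finset.card_insert_of_notMem (hq b), Nat.card_Ico] at hcard
    obtain ⟨m, hm⟩ : ∃ m, S.card = m + 1 := Nat.exists_eq_succ_of_ne_zero hne.card_ne_zero
    have hIc : (insert q (Finset.Ico a (a + m))).card = S.card := by
      rw [Finset.card_insert_of_notMem (hq _), Nat.card_Ico, hm]; omega
    refine ⟨insert q (Finset.Ico a (a + m)), Finset.insert_subset_insert _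
      (Finset.Ico_subset_Ico le_rfl (by omega)), hIc, ?_⟩
    refine le_trans ?_ (sum_le_sum_of_card_eq _ hIc ?_)
    · rw [hμ, Finset.sum_insert (hq _), hqlow]
      rcases Nat.eq_zero_or_pos m with rfl | hpos
      · simpa using hc
      · rw [sum_lowered d _ (Finset.mem_Ico.2 ⟨le_rfl, by omega⟩),
          sum_Ico_eq_add_excess lam d (by omega)]
        have := hmin (a + m) (by omega) (by omega)
        linarith
    · intro x hx y hy hyI
      simp only [Finset.mem_insert, Finset.mem_Ico, not_or, not_and, not_lt] at hx hyI
      have hyb := Finset.mem_Ico.1 ((Finset.mem_insert.1 (hS hy)).resolve_left hyI.1)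
      have hym := hyI.2 hyb.1
      rcases hx with rfl | hx
      · rw [hqlow, lowered]
        split_ifs with h
        · rwa [h]
        · exact hd (by omega)
      · have hxy := hd (show x ≤ y by omega)
        rw [lowered, lowered, if_neg (show y ≠ a by omega)]
        split_ifs <;> linarith
  · rw [hμ, Finset.sum_insert (hq _), hqlow, sum_lowered d _ (Finset.mem_Ico.2 ⟨le_rfl, hab⟩),
      sum_Ico_eq_add_excess lam d hab.le, hc']
    ring

/-- An initial block on which only the excesses beyond `N` are at least the final one: the surplus
is taken off a target that is large enough to be still larger than the first `N + 1` targets. -/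
theorem majorizedOn_range {lam d : ℕ → ℝ} (hd : Monotone d)
    (hnonneg : ∀ m, 0 ≤ excess lam d m) {N q b : ℕ} (hqb : q < b)
    (hmin : ∀ m, N < m → m ≤ b → excess lam d b ≤ excess lam d m)
    (hq : d N + excess lam d b ≤ d q) :
    MajorizedOn (Finset.Ico 0 b) lam (lowered d q (excess lam d b)) := by
  have hsum : ∀ m, ∑ i ∈ Finset.Ico 0 m, d i = ∑ i ∈ Finset.Ico 0 m, lam i + excess lam d m := by
    intro m
    rw [sum_Ico_eq_add_excess lam d (Nat.zero_le m), excess_zero, sub_zero]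
  have hinit : ∀ S : Finset ℕ, ∑ i ∈ Finset.Ico 0 S.card, d i ≤ ∑ i ∈ S, d i := by
    intro S
    refine sum_le_sum_of_card_eq d (by simp) fun x hx y _ hy => hd ?_
    rw [Finset.mem_Ico] at hx hy
    omega
  refine ⟨fun S hS => ?_, ?_⟩
  · have hcard := Finset.card_le_card hS
    rw [Nat.card_Ico] at hcard
    refine ⟨Finset.Ico 0 S.card, Finset.Ico_subset_Ico le_rfl (by omega), by simp, ?_⟩
    by_cases hqS : q ∈ S
    · rw [sum_lowered d _ hqS]
      rcases le_or_gt S.card N with hm | hm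
      · have h1 := hinit (S.erase q)
        rw [← Finset.add_sum_erase S d hqS]
        obtain ⟨m, hSm⟩ : ∃ m, S.card = m + 1 :=
          Nat.exists_eq_succ_of_ne_zero (Finset.card_ne_zero_of_mem hqS)
        rw [Finset.card_erase_of_mem hqS, hSm, Nat.add_sub_cancel] at h1
        have h2 := hsum (m + 1)
        have h3 := hnonneg (m + 1)
        rw [Finset.sum_Ico_succ_top (Nat.zero_le m)] at h2
        have h4 := hd (show m ≤ N by omega)
        rw [hSm]
        linarith
      · have h1 := hinit S
        rw [hsum] at h1
        have := hmin _ hm (by omega)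
        linarith
    · rw [sum_lowered_of_notMem d _ hqS]
      have h1 := hinit S
      rw [hsum] at h1
      linarith [hnonneg S.card]
  · rw [sum_lowered d _ (Finset.mem_Ico.2 ⟨Nat.zero_le _, hqb⟩), hsum]
    ring

/-! ### Choice of the blocks -/

/-- The blocks when the excess attains its minimum beyond every index: they end at such minima, so
the surplus of every block is nonnegative, and the chains are chosen so sparse that the gap
condition holds. Along a chain the deficits add up. -/
theorem nonempty_blockPlan_of_attained {lam d : ℕ → ℝ} (hlam : Monotone lam)
    (hlam_unbdd : ¬ BddAbove (Set.range lam)) (hd : Monotone d)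
    (hnonneg : ∀ m, 0 ≤ excess lam d m)
    (h : ∀ N, ∃ n > N, ∀ m > N, excess lam d n ≤ excess lam d m) :
    Nonempty (BlockPlan lam d) := by
  choose f hf1 hf2 using h
  let n : ℕ → ℕ := fun k => f^[k] 0
  have hn0 : n 0 = 0 := rfl
  have hns : ∀ k, n (k + 1) = f (n k) := fun k => Function.iterate_succ_apply' f k 0
  have hnlt : ∀ k, n k < n (k + 1) := fun k => by rw [hns]; exact hf1 _
  have hnmono : StrictMono n := strictMono_nat_of_lt_succ hnlt
  have hmin : ∀ k m, n k < m → excess lam d (n (k + 1)) ≤ excess lam d m := fun k m hm => by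
    rw [hns]; exact hf2 _ m hm
  let Δ : ℕ → ℝ := fun k => excess lam d (n (k + 1)) - excess lam d (n k)
  have hΔ : ∀ k, 0 ≤ Δ k := by
    rintro (_ | k)
    · simpa [Δ, hn0, excess_zero] using hnonneg (n 1)
    · exact sub_nonneg.2 (hmin k _ (hnmono (by omega)))
  have hlim : Filter.Tendsto (fun k => lam (n k)) Filter.atTop Filter.atTop :=
    (Filter.tendsto_atTop_atTop_of_monotone' hlam hlam_unbdd).comp hnmono.tendsto_atTop
  obtain ⟨σ, hσ, hσP⟩ := Filter.extraction_forall_of_eventually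
    (P := fun j k => j < k ∧ d (n j) + excess lam d (n (j + 1)) < lam (n k))
    fun j => (Filter.eventually_gt_atTop j).and (hlim.eventually_gt_atTop _)
  classical
  have hit : ∀ s i, i ≤ σ^[s] i := by
    intro s
    induction s with
    | zero => intro i; exact le_rfl
    | succ s ih => intro i; rw [Function.iterate_succ_apply']; exact (ih i).trans (hσP _).1.le
  -- `anc k` consists of the members of the chain of `k` up to `k`
  let anc : ℕ → Finset ℕ := fun k => (Finset.range (k + 1)).filter fun i => ∃ s, σ^[s] i = k
  have hmem : ∀ k i, i ∈ anc k ↔ ∃ s, σ^[s] i = k := by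
    intro k i
    simp only [anc, Finset.mem_filter, Finset.mem_range, and_iff_right_iff_imp]
    rintro ⟨s, rfl⟩
    exact Nat.lt_succ_of_le (hit s i)
  have hanc_root : ∀ k, (∀ j, σ j ≠ k) → anc k = {k} := by
    intro k hk
    ext i
    rw [hmem, Finset.mem_singleton]
    constructor
    · rintro ⟨_ | s, hs⟩
      · exact hs
      · rw [Function.iterate_succ_apply'] at hs
        exact absurd hs (hk _)
    · rintro rfl; exact ⟨0, rfl⟩
  have hanc_succ : ∀ j, anc (σ j) = insert (σ j) (anc j) := by
    intro j
    ext i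
    rw [Finset.mem_insert, hmem, hmem]
    constructor
    · rintro ⟨_ | s, hs⟩
      · exact Or.inl hs
      · rw [Function.iterate_succ_apply'] at hs
        exact Or.inr ⟨s, hσ.injective hs⟩
    · rintro (rfl | ⟨s, rfl⟩)
      · exact ⟨0, rfl⟩
      · exact ⟨s + 1, Function.iterate_succ_apply' σ s i⟩
  let C : ℕ → ℝ := fun k => ∑ i ∈ anc k, Δ i
  have hC0 : ∀ k, 0 ≤ C k := fun k => Finset.sum_nonneg fun i _ => hΔ i
  have hCroot : ∀ k, (∀ j, σ j ≠ k) → C k = Δ k := by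
    intro k hk
    simp [C, hanc_root k hk]
  have hCsucc : ∀ j, C (σ j) = C j + Δ (σ j) := by
    intro j
    have hnot : σ j ∉ anc j := by
      intro hm
      have := Finset.mem_range.1 (Finset.mem_filter.1 hm).1
      have := (hσP j).1
      omega
    simp only [C, hanc_succ, Finset.sum_insert hnot]
    ring
  have hCle : ∀ k, C k ≤ excess lam d (n (k + 1)) := by
    intro k
    calc C k ≤ ∑ i ∈ Finset.range (k + 1), Δ i :=
          Finset.sum_le_sum_of_subset_of_nonneg (Finset.filter_subset _ _) fun i _ _ => hΔ i
      _ = excess lam d (n (k + 1)) := by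
          rw [Finset.sum_range_sub (fun k => excess lam d (n k)), hn0, excess_zero, sub_zero]
  have hgap : ∀ j, d (n j) + C j < lam (n (σ j)) := fun j =>
    lt_of_le_of_lt (by linarith [hCle j]) (hσP j).2
  refine ⟨⟨n, n, σ, C, hn0, hnmono, fun _ => le_rfl, hnlt, hσ.injective, fun j => (hσP j).1, hC0,
    fun j => ?_, fun k hk => ?_, fun j i hi => ?_⟩⟩
  · exact majorizedOn_insert_Ico hd (hnmono (hσP j).1) (hnlt _) (hC0 j)
      (fun m hm _ => hmin _ m hm) (hCsucc j) (hC0 _) (hgap j)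
  · rw [hCroot k hk]
    exact majorizedOn_Ico hd (hnlt k) (fun m hm _ => hmin k m hm) (sub_nonneg.1 (hΔ k))
  · exact (hgap j).trans_le (hlam (Finset.mem_Ico.1 hi).1)

/-- The blocks when, beyond some index `N`, the excess does not attain its infimum: they end at
indices where the excess is minimal so far, and form a single chain, whose deficit is the excess
itself and hence decreases. -/
theorem nonempty_blockPlan_of_not_attained {lam d : ℕ → ℝ} (hlam : Monotone lam)
    (hlam_unbdd : ¬ BddAbove (Set.range lam)) (hd : Monotone d)
    (hd_unbdd : ¬ BddAbove (Set.range d)) (hnonneg : ∀ m, 0 ≤ excess lam d m) {N : ℕ}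
    (h : ∀ n > N, ∃ m > N, excess lam d m < excess lam d n) :
    Nonempty (BlockPlan lam d) := by
  -- records of the excess beyond `N` occur arbitrarily late
  have hrec : ∀ M, ∃ n > M, N < n ∧ ∀ m, N < m → m ≤ n → excess lam d n ≤ excess lam d m := by
    intro M
    obtain ⟨a, ha, hamin⟩ := Finset.exists_min_image (Finset.Ioc N (N + 1 + M)) (excess lam d)
      ⟨N + 1, Finset.mem_Ioc.2 (by omega)⟩
    have hex := h a (Finset.mem_Ioc.1 ha).1
    classical
    obtain ⟨h1, h2⟩ := Nat.find_spec hex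
    have h3 := fun m (hm : m < Nat.find hex) => Nat.find_min hex hm
    generalize Nat.find hex = k at h1 h2 h3
    refine ⟨k, ?_, h1, fun m hm hmk => ?_⟩
    · by_contra! hk
      exact absurd (hamin k (Finset.mem_Ioc.2 (by omega))) (not_le.2 h2)
    · rcases hmk.eq_or_lt with rfl | hlt
      · exact le_rfl
      · by_contra! hc
        exact h3 m hlt ⟨hm, hc.trans h2⟩
  have hunb : ∀ {g : ℕ → ℝ}, ¬ BddAbove (Set.range g) → ∀ x, ∃ i, x < g i := by
    intro g hg x
    by_contra! hx
    exact hg ⟨x, by rintro _ ⟨i, rfl⟩; exact hx i⟩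
  have hstep : ∀ x, ∃ n > x, N < n ∧ d x + excess lam d (N + 1) < lam n ∧
      ∀ m, N < m → m ≤ n → excess lam d n ≤ excess lam d m := by
    intro x
    obtain ⟨i, hi⟩ := hunb hlam_unbdd (d x + excess lam d (N + 1))
    obtain ⟨n, hn, hN, hmin⟩ := hrec (max x i)
    exact ⟨n, by omega, hN, hi.trans_le (hlam (by omega)), hmin⟩
  choose f hf1 hf2 hf3 hf4 using hstep
  obtain ⟨p, hp⟩ := hunb hd_unbdd (d N + excess lam d (N + 1))
  let y : ℕ → ℕ := fun k => f^[k] p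
  have hys : ∀ k, y (k + 1) = f (y k) := fun k => Function.iterate_succ_apply' f k p
  have hylt : ∀ k, y k < y (k + 1) := fun k => by rw [hys]; exact hf1 _
  have hyN : ∀ k, N < y (k + 1) := fun k => by rw [hys]; exact hf2 _
  have hgap : ∀ k, d (y k) + excess lam d (N + 1) < lam (y (k + 1)) := fun k => by
    rw [hys]; exact hf3 _
  have hmin : ∀ k m, N < m → m ≤ y (k + 1) → excess lam d (y (k + 1)) ≤ excess lam d m :=
    fun k => by rw [hys]; exact hf4 _
  have hle : ∀ k, excess lam d (y (k + 1)) ≤ excess lam d (N + 1) := fun k =>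
    hmin k (N + 1) (by omega) (hyN k)
  -- the first block is `[0, y 1)`, with left-over index `p = y 0`; block `k > 0` starts at `y k`
  let n : ℕ → ℕ := fun k => if k = 0 then 0 else y k
  have hns : ∀ k, n (k + 1) = y (k + 1) := fun k => if_neg (Nat.succ_ne_zero k)
  have hny : ∀ k, n k ≤ y k := fun k => by
    rcases k with _ | k
    · exact Nat.zero_le _
    · exact (hns k).le
  have hyn : ∀ k, y k < n (k + 1) := fun k => by rw [hns]; exact hylt k
  refine ⟨⟨n, y, Nat.succ, fun k => excess lam d (y (k + 1)), rfl,
    strictMono_nat_of_lt_succ fun k => (hny k).trans_lt (hyn k), hny, hyn, Nat.succ_injective,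
    Nat.lt_succ_self, fun k => hnonneg _, fun j => ?_, fun k hk => ?_, fun j i hi => ?_⟩⟩
  · simp only [Nat.succ_eq_add_one, hns]
    exact majorizedOn_insert_Ico hd (hylt j) (hylt _) (hnonneg _)
      (fun m hm hm' => hmin (j + 1) m ((hyN j).trans hm) hm') (by ring) (hnonneg _)
      (lt_of_le_of_lt (by linarith [hle j]) (hgap j))
  · obtain rfl : k = 0 := by
      rcases k with _ | k
      · rfl
      · exact absurd rfl (hk k)
    rw [show n 0 = 0 from rfl, hns 0]
    refine majorizedOn_range hd hnonneg (hylt 0) (hmin 0) ?_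
    exact (show d N + excess lam d (y 1) ≤ d p by linarith [hle 0])
  · have hi' := (Finset.mem_Ico.1 hi).1
    rw [Nat.succ_eq_add_one, hns] at hi'
    exact (lt_of_le_of_lt (by linarith [hle j]) (hgap j)).trans_le (hlam hi')

theorem nonempty_rotationSchedule {lam d : ℕ → ℝ} (hlam : Monotone lam)
    (hlam_unbdd : ¬ BddAbove (Set.range lam)) (hd : Monotone d)
    (hd_unbdd : ¬ BddAbove (Set.range d))
    (hmaj : ∀ n : ℕ, ∑ i ∈ Finset.range n, lam i ≤ ∑ i ∈ Finset.range n, d i) :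
    Nonempty (RotationSchedule lam d) := by
  have hnonneg : ∀ m, 0 ≤ excess lam d m := by
    intro m
    rw [excess, Finset.sum_sub_distrib]
    linarith [hmaj m]
  have hP : Nonempty (BlockPlan lam d) := by
    by_cases h : ∀ N, ∃ n > N, ∀ m > N, excess lam d n ≤ excess lam d m
    · exact nonempty_blockPlan_of_attained hlam hlam_unbdd hd hnonneg h
    · push Not at h
      obtain ⟨N, hN⟩ := h
      exact nonempty_blockPlan_of_not_attained hlam hlam_unbdd hd hd_unbdd hnonneg hN
  exact hP.some.nonempty_schedule

/-! ### Realization in the Hilbert space -/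

section Realization

variable {𝕜 : Type*} [RCLike 𝕜] {H : Type*} [NormedAddCommGroup H] [InnerProductSpace 𝕜 H]

/-- The vector with finitely many real coordinates `f` in the basis `v`. -/
noncomputable def ofCoords (v : HilbertBasis ℕ 𝕜 H) (f : ℕ →₀ ℝ) : H :=
  Finsupp.linearCombination 𝕜 v (f.mapRange (fun a : ℝ => (a : 𝕜)) RCLike.ofReal_zero)

theorem ofCoords_mem_span (v : HilbertBasis ℕ 𝕜 H) (f : ℕ →₀ ℝ) :
    ofCoords v f ∈ Submodule.span 𝕜 (Set.range v) :=
  Finsupp.mem_span_range_iff_exists_finsupp.2 ⟨_, rfl⟩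

theorem inner_basis_ofCoords (v : HilbertBasis ℕ 𝕜 H) (f : ℕ →₀ ℝ) (i : ℕ) :
    inner 𝕜 (v i) (ofCoords v f) = (f i : 𝕜) := by
  rw [ofCoords, v.orthonormal.inner_right_finsupp, Finsupp.mapRange_apply]

theorem inner_ofCoords_right (v : HilbertBasis ℕ 𝕜 H) (x : H) (f : ℕ →₀ ℝ) :
    inner 𝕜 x (ofCoords v f) = f.sum fun i a => (a : 𝕜) * inner 𝕜 x (v i) := by
  rw [ofCoords, Finsupp.linearCombination_apply, Finsupp.sum_mapRange_index (by simp),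
    Finsupp.inner_sum]
  simp [inner_smul_right]

theorem inner_ofCoords_ofCoords (v : HilbertBasis ℕ 𝕜 H) (f g : ℕ →₀ ℝ) :
    inner 𝕜 (ofCoords v f) (ofCoords v g) = ((diagForm (fun _ => 1) f g : ℝ) : 𝕜) := by
  rw [← inner_conj_symm, inner_ofCoords_right, diagForm_apply, Finsupp.sum, Finsupp.sum]
  simp only [← inner_conj_symm (ofCoords v g), inner_basis_ofCoords]
  simp

theorem ofCoords_mem_domain (lam : ℕ → ℝ) (v : HilbertBasis ℕ 𝕜 H) (f : ℕ →₀ ℝ) :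
    ofCoords v f ∈ (SchurHorn.diagOp lam v).domain := by
  have h : Submodule.span 𝕜 (Set.range v) ≤ (SchurHorn.diagOp lam v).domain := by
    rw [Submodule.span_le]
    rintro _ ⟨i, rfl⟩
    exact SchurHorn.basis_mem_domain lam v i
  exact h (ofCoords_mem_span v f)

theorem inner_diagOp_ofCoords (lam : ℕ → ℝ) (v : HilbertBasis ℕ 𝕜 H) (f : ℕ →₀ ℝ)
    (hf : ofCoords v f ∈ (SchurHorn.diagOp lam v).domain) :
    inner 𝕜 (SchurHorn.diagOp lam v ⟨ofCoords v f, hf⟩) (ofCoords v f) =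
      ((diagForm lam f f : ℝ) : 𝕜) := by
  rw [inner_ofCoords_right, diagForm_apply, Finsupp.sum, Finsupp.sum]
  simp only [← inner_conj_symm _ (v _), SchurHorn.inner_diagOp, inner_basis_ofCoords]
  simp

end Realization

theorem theorem1p1 {𝕜 : Type*} [RCLike 𝕜] {H : Type*} [NormedAddCommGroup H]
    [InnerProductSpace 𝕜 H] [CompleteSpace H]
    (lam d : ℕ → ℝ)
    (hlam : Monotone lam) (hlam_unbdd : ¬ BddAbove (Set.range lam))
    (hd : Monotone d) (hd_unbdd : ¬ BddAbove (Set.range d))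
    (hmaj : ∀ n : ℕ, ∑ i ∈ Finset.range n, lam i ≤ ∑ i ∈ Finset.range n, d i)
    (v : HilbertBasis ℕ 𝕜 H) :
    ∃ e : HilbertBasis ℕ 𝕜 H,
      (∀ i, e i ∈ Submodule.span 𝕜 (Set.range v)) ∧
      ∀ i, ∃ hi : e i ∈ (SchurHorn.diagOp lam v).domain,
        inner 𝕜 (SchurHorn.diagOp lam v ⟨e i, hi⟩) (e i) = (d i : 𝕜) := by
  obtain ⟨R⟩ := nonempty_rotationSchedule hlam hlam_unbdd hd hd_unbdd hmaj
  obtain ⟨e, he1, he2, he3⟩ := R.exists_complete (W := 𝕜) (diagForm fun _ => 1) (diagForm lam)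
    (fun i => Finsupp.single i 1) (diagForm_single _) (diagForm_single _)
  have hon : Orthonormal 𝕜 fun i => ofCoords v (e i) := by
    rw [orthonormal_iff_ite]
    intro i j
    rw [inner_ofCoords_ofCoords, he1]
    split_ifs <;> simp
  have hbot : (Submodule.span 𝕜 (Set.range fun i => ofCoords v (e i)))ᗮ = ⊥ := by
    rw [Submodule.eq_bot_iff]
    intro x hx
    have hφ : ∀ f : ℕ →₀ ℝ, Finsupp.linearCombination ℝ (fun i => inner 𝕜 x (v i)) f =
        inner 𝕜 x (ofCoords v f) := by
      intro f
      rw [inner_ofCoords_right, Finsupp.linearCombination_apply]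
      simp only [RCLike.real_smul_eq_coe_mul]
    have hzero := he3 (Finsupp.linearCombination ℝ fun i => inner 𝕜 x (v i)) ‖x‖
      (by
        intro f hf
        have hn : ‖ofCoords v f‖ = 1 := by
          have h := inner_self_eq_norm_sq_to_K (𝕜 := 𝕜) (ofCoords v f)
          rw [inner_ofCoords_ofCoords, hf] at h
          have h' : ‖ofCoords v f‖ ^ 2 = 1 := by exact_mod_cast h.symm
          nlinarith [norm_nonneg (ofCoords v f)]
        rw [hφ]
        simpa [hn] using norm_inner_le_norm (𝕜 := 𝕜) x (ofCoords v f))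
      (by
        intro i
        rw [hφ]
        exact (Submodule.mem_orthogonal' _ _).1 hx _ (Submodule.subset_span ⟨i, rfl⟩))
    apply v.repr.injective
    ext i
    have := hzero i
    rw [Finsupp.linearCombination_single, one_smul] at this
    rw [v.repr_apply_apply, ← inner_conj_symm, this, map_zero, map_zero]
    rfl
  refine ⟨HilbertBasis.mkOfOrthogonalEqBot hon hbot, ?_⟩
  rw [HilbertBasis.coe_mkOfOrthogonalEqBot]
  refine ⟨fun i => ofCoords_mem_span v (e i), fun i => ⟨ofCoords_mem_domain lam v (e i), ?_⟩⟩
  rw [inner_diagOp_ofCoords, he2]
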